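/- For $s\in\mathbb{C}$ let $\mathrm{Li}_s(z)=\sum_{k\ge1}z^k/k^s$ for $|z|<1$, continued analytically to $\mathbb{C}\setminus[1,\infty)$ (principal branch), with the boundary values from $\Im z<0$ on the cut $(1,\infty)$. For real $s<1$ this continuation, with its boundary values, exists. Let $p^{s-1}=e^{(s-1)\operatorname{Log}p}$ with $-\pi<\Im\operatorname{Log}p\le\pi$. The product $\Gamma(s)\sin(\pi s)$ has finite limits at $s=0,-1,-2,\dots$ and stands for these limits there. **Lemma 18 (a ramified dyadic identity).** Let $s<1$ be real. Then, in $\mathbb{C}\setminus\{0\}$, $$\pi\,p^{s-1}=\Gamma(s)\sin(\pi s)\Big[\mathrm{Li}_s(e^{-p})-\sum_{k=1}^{\infty}2^{-k(1-s)}\,\mathrm{Li}_s\big(-e^{-2^{-k}p}\big)\Big].$$ More precisely, for every $p\in\mathbb{C}\setminus 2\pi i\mathbb{Z}$ the series converges absolutely and the equality holds, and each point $p=2\pi i n$ with $n\in\mathbb{Z}\setminus\{0\}$ is a removable singularity of the right-hand side, whose limit there is $\pi p^{s-1}$. For $s=0$ one has $\Gamma(s)\sin(\pi s)=\pi$ (in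 the sense above), $p^{s-1}=1/p$, and the bracket equals $\frac1{1-e^{-p}}-\sum_{k\ge1}\frac{2^{-k}}{1+e^{-p/2^k}}$ for $p\notin 2\pi i\mathbb{Z}$, with an absolutely convergent series, so that the identity reduces to the dyadic identity $$\frac1p=\frac{1}{1-e^{-p}}-\sum_{k=1}^{\infty}\frac{2^{-k}}{1+e^{-p/2^k}}.$$ -/

import Mathlib

open Filter Topology

noncomputable section

/-- `L` is the principal branch of the polylogarithm of order `s`: it is the sum of
`∑_{k ≥ 1} z ^ k / k ^ s` in the open unit disk, it is analytic in the plane cut along `[1, ∞)`,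
and on `(1, ∞)` it takes the boundary values from the lower side of the cut. (The value at the
branch point `z = 1` is not prescribed.) -/
structure IsPolylog (s : ℂ) (L : ℂ → ℂ) : Prop where
  hasSum : ∀ z : ℂ, ‖z‖ < 1 → HasSum (fun k : ℕ => z ^ (k + 1) / ((k : ℂ) + 1) ^ s) (L z)
  analytic : AnalyticOnNhd ℂ L {z : ℂ | ¬ (z.im = 0 ∧ 1 ≤ z.re)}
  boundary : ∀ x : ℝ, 1 < x → Tendsto L (𝓝[{z : ℂ | z.im < 0}] (x : ℂ)) (𝓝 (L x))

open Classical in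
/-- The polylogarithm `Li_s(z)`, defined from its power series by analytic continuation. -/
def polylog (s : ℂ) : ℂ → ℂ :=
  if h : ∃ L : ℂ → ℂ, IsPolylog s L then h.choose else 0

/-- The product `Γ(s) sin(π s)`, extended by its limit to the points `s = 0, -1, -2, …`, where
the simple pole of `Γ` meets a zero of the sine. -/
def gammaSin (s : ℝ) : ℝ :=
  limUnder (𝓝[≠] s) (fun t : ℝ => Real.Gamma t * Real.sin (Real.pi * t))

/-- The term of index `k + 1` of the dyadic series:
`2 ^ (-(k + 1)(1 - s)) Li_s(-exp(-2 ^ (-(k + 1)) p))`. -/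
def dyadicTerm (s : ℝ) (p : ℂ) (k : ℕ) : ℂ :=
  (2 : ℂ) ^ (-((k : ℂ) + 1) * (1 - (s : ℂ))) * polylog s (-Complex.exp (-(p / 2 ^ (k + 1))))

/-- `Li_s(exp(-p)) - ∑_{k ≥ 1} 2 ^ (-k(1 - s)) Li_s(-exp(-2 ^ (-k) p))`. -/
def dyadicBracket (s : ℝ) (p : ℂ) : ℂ :=
  polylog s (Complex.exp (-p)) - ∑' k : ℕ, dyadicTerm s p k

/-- `p` is one of the points `2 π i n`, `n ∈ ℤ`. -/
def IsPeriodPoint (p : ℂ) : Prop := ∃ n : ℤ, p = 2 * Real.pi * Complex.I * n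

end

/-! The duplication formula Li_s(z) + Li_s(-z) = 2^(1-s) Li_s(z^2), applied to z = exp(-p/2^(N+1)),
telescopes: the bracket truncated after N terms equals 2^(N(s-1)) Li_s(exp(-p/2^N)). Its argument
tends to the branch point 1, where Li_s(exp(-q)) = Γ(1-s) q^(s-1) + h(q) with h regular at 0. The
prefactor exactly undoes the scaling of q^(s-1) and, since s < 1, kills h. Hence the bracket is
Γ(1-s) p^(s-1) (`dyadicBracket_eq`), and the reflection formula supplies the coefficient.

The expansion carries the weight (`exists_polylog_exp_neg_eq`). For 0 < s < 1 it comes from the Bose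
integral by splitting 1/(e^w - 1) into 1/w and a holomorphic remainder; for s = 0 it is explicit.
The operator z d/dz, which is -d/dq for z = exp(-q), then lowers s by one, reaching every s < 1.

On the cut, q = -log z turns the lower side of (1, ∞) into the upper side of the negative axis,
where the principal logarithm is continuous. The same expansion therefore holds for q < 0, and no
case distinction in p is needed. -/

/-! ### Holomorphic parameter integrals -/

open MeasureTheory Metric in
/-- An integral of holomorphic functions that are dominated on a ball is holomorphic. -/
theorem differentiableAt_integral_of_dominated {α : Type*} [MeasurableSpace α] {μ : Measure α}
    {F : ℂ → α → ℂ} {bound : α → ℝ} {z₀ : ℂ} {r : ℝ} (hr : 0 < r)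
    (hmeas : ∀ z ∈ ball z₀ r, AEStronglyMeasurable (F z) μ)
    (hbound : ∀ᵐ a ∂μ, ∀ z ∈ ball z₀ r, ‖F z a‖ ≤ bound a) (hint : Integrable bound μ)
    (hdiff : ∀ᵐ a ∂μ, DifferentiableOn ℂ (fun z => F z a) (ball z₀ r)) :
    DifferentiableAt ℂ (fun z => ∫ a, F z a ∂μ) z₀ := by
  have hz₀ : z₀ ∈ ball z₀ r := mem_ball_self hr
  have hd : ∀ᵐ a ∂μ, ∀ z ∈ ball z₀ (r / 2),
      HasDerivAt (fun z => F z a) (deriv (fun z => F z a) z) z := by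
    filter_upwards [hdiff] with a ha z hz
    exact (ha.differentiableAt
      (isOpen_ball.mem_nhds (ball_subset_ball (by linarith) hz))).hasDerivAt
  -- The derivative bound is Cauchy's estimate on discs of radius r/3 centred in the ball of radius
  -- r/2; they stay inside since 1/2 + 1/3 < 1.
  have key := hasDerivAt_integral_of_dominated_loc_of_deriv_le (μ := μ) (F := F) (x₀ := z₀)
    (s := ball z₀ (r / 2)) (bound := fun a => bound a / (r / 3))
    (F' := fun z a => deriv (fun z => F z a) z) (ball_mem_nhds _ (by positivity))
    (by filter_upwards [ball_mem_nhds z₀ hr] with z hz using hmeas z hz)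
    (hint.mono' (hmeas _ hz₀) (by filter_upwards [hbound] with a ha using ha _ hz₀))
    ?_ ?_ (hint.div_const _) hd
  · exact key.2.differentiableAt
  -- The derivative at z₀ is measurable as an a.e. limit of difference quotients along a sequence.
  · let h : ℕ → ℂ := fun n => ((r / 2 / (n + 1) : ℝ) : ℂ)
    have hpos : ∀ n : ℕ, 0 < r / 2 / ((n : ℝ) + 1) := fun n => by positivity
    have hmem : ∀ n, z₀ + h n ∈ ball z₀ r := by
      intro n
      have : r / 2 / ((n : ℝ) + 1) ≤ r / 2 := div_le_self (by positivity) (by simp)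
      simp only [h, mem_ball, dist_self_add_left, Complex.norm_real, Real.norm_eq_abs,
        abs_of_pos (hpos n)]
      linarith
    have hlim : Tendsto h atTop (𝓝[≠] 0) := by
      refine tendsto_nhdsWithin_iff.2 ⟨?_, Eventually.of_forall fun n => ?_⟩
      · have : Tendsto (fun n : ℕ => r / 2 / ((n : ℝ) + 1)) atTop (𝓝 0) :=
          tendsto_const_nhds.div_atTop (tendsto_natCast_atTop_atTop.atTop_add tendsto_const_nhds)
        exact (Complex.continuous_ofReal.tendsto' 0 0 Complex.ofReal_zero).comp this
      · exact Complex.ofReal_ne_zero.2 (hpos n).ne'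
    refine aestronglyMeasurable_of_tendsto_ae atTop
      (f := fun n a => (h n)⁻¹ • (F (z₀ + h n) a - F z₀ a))
      (fun n => by exact ((hmeas _ (hmem n)).sub (hmeas _ hz₀)).const_smul (h n)⁻¹) ?_
    filter_upwards [hd] with a ha
    exact (hasDerivAt_iff_tendsto_slope_zero.1 (ha z₀ (mem_ball_self (by positivity)))).comp hlim
  · filter_upwards [hbound, hdiff] with a ha hda z hz
    have hsub : closedBall z (r / 3) ⊆ ball z₀ r := by
      refine closedBall_subset_ball' ?_
      have := mem_ball.1 hz
      linarith
    exact Complex.norm_deriv_le_of_forall_mem_sphere_norm_le (by positivity)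
      ((hda.mono hsub).diffContOnCl_ball subset_rfl)
      fun w hw => ha w (hsub (sphere_subset_closedBall hw))

/-! ### The regular part of 1/(e^w - 1) -/

/-- The function `1 / (e ^ w - 1) - 1 / w`, with its removable singularity at `0` removed. -/
noncomputable def expSubOneInvRemainder (w : ℂ) : ℂ :=
  -(dslope (dslope Complex.exp 0) 0 w) / dslope Complex.exp 0 w

theorem differentiable_dslope_exp : Differentiable ℂ (dslope Complex.exp 0) :=
  differentiableOn_univ.1 ((Complex.differentiableOn_dslope univ_mem).2
    Complex.differentiable_exp.differentiableOn)

theorem dslope_exp_of_ne {w : ℂ} (hw : w ≠ 0) :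
    dslope Complex.exp 0 w = (Complex.exp w - 1) / w := by
  rw [dslope_of_ne _ hw, slope_def_field, Complex.exp_zero, sub_zero]

theorem exp_ne_one_of_abs_im_lt {w : ℂ} (hw : w ≠ 0) (him : |w.im| < 2 * Real.pi) :
    Complex.exp w ≠ 1 := by
  intro h
  obtain ⟨n, rfl⟩ := Complex.exp_eq_one_iff.1 h
  have hn : n ≠ 0 := by rintro rfl; simp at hw
  have h1 : (1 : ℝ) ≤ |(n : ℝ)| := by exact_mod_cast Int.one_le_abs hn
  have h2 : ((n : ℂ) * (2 * Real.pi * Complex.I)).im = n * (2 * Real.pi) := by simp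
  rw [h2, abs_mul, abs_of_pos Real.two_pi_pos] at him
  nlinarith [Real.pi_pos]

theorem dslope_exp_ne_zero {w : ℂ} (him : |w.im| < 2 * Real.pi) :
    dslope Complex.exp 0 w ≠ 0 := by
  rcases eq_or_ne w 0 with rfl | hw
  · simp
  · rw [dslope_exp_of_ne hw]
    exact div_ne_zero (sub_ne_zero.2 (exp_ne_one_of_abs_im_lt hw him)) hw

/-- With g(w) = (e^w - 1)/w and g(0) = 1, one has 1/(w g) - 1/w = -((g - 1)/w)/g, and (g - 1)/w is
again a `dslope`. -/
theorem expSubOneInvRemainder_eq {w : ℂ} (hw : w ≠ 0) (him : |w.im| < 2 * Real.pi) :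
    expSubOneInvRemainder w = 1 / (Complex.exp w - 1) - 1 / w := by
  have h1 : Complex.exp w - 1 ≠ 0 := sub_ne_zero.2 (exp_ne_one_of_abs_im_lt hw him)
  rw [expSubOneInvRemainder, dslope_of_ne _ hw, slope_def_field, dslope_exp_of_ne hw, dslope_same]
  simp only [Complex.deriv_exp, Complex.exp_zero, sub_zero]
  field_simp
  ring

theorem differentiableOn_expSubOneInvRemainder :
    DifferentiableOn ℂ expSubOneInvRemainder {w : ℂ | |w.im| < 2 * Real.pi} := by
  have h : Differentiable ℂ (dslope (dslope Complex.exp 0) 0) :=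
    differentiableOn_univ.1 ((Complex.differentiableOn_dslope univ_mem).2
      differentiable_dslope_exp.differentiableOn)
  exact h.neg.differentiableOn.div differentiable_dslope_exp.differentiableOn
    fun w hw => dslope_exp_ne_zero hw

/-- Compactness handles Re w ≤ 1; beyond, both fractions are at most 1/Re w. The shift by R makes
the bound at w = t + q at most C/(1 + t) whenever Re q ≥ -R, uniformly in q. -/
theorem exists_norm_expSubOneInvRemainder_le (R : ℝ) (hR : 0 ≤ R) :
    ∃ C : ℝ, ∀ w : ℂ, -R ≤ w.re → |w.im| ≤ Real.pi →
      ‖expSubOneInvRemainder w‖ ≤ C / (1 + (R + w.re)) := by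
  have hpi := Real.pi_pos
  have hK : IsCompact (Set.Icc (-R) 1 ×ℂ Set.Icc (-Real.pi) Real.pi) :=
    isCompact_Icc.reProdIm isCompact_Icc
  obtain ⟨C, hC⟩ := hK.exists_bound_of_continuousOn (f := expSubOneInvRemainder)
    (differentiableOn_expSubOneInvRemainder.continuousOn.mono fun w hw => by
      have := abs_le.2 hw.2
      simp only [Set.mem_ofPred_eq]
      linarith)
  have hC0 : 0 ≤ C := by
    refine (norm_nonneg _).trans (hC 0 ⟨?_, ?_⟩)
    · simp [hR]
    · simp [hpi.le]
  refine ⟨max (C * (2 + R)) (2 * (2 + R)), fun w hre him => ?_⟩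
  rw [le_div_iff₀ (by linarith)]
  rcases le_total w.re 1 with h | h
  · refine le_trans ?_ (le_max_left _ _)
    exact mul_le_mul (hC w ⟨⟨hre, h⟩, abs_le.1 him⟩) (by linarith) (by linarith) hC0
  · refine le_trans ?_ (le_max_right _ _)
    have hw : w ≠ 0 := by rintro rfl; simp at h; linarith
    have h0 : 0 < w.re := by linarith
    have h1 : w.re ≤ ‖Complex.exp w - 1‖ := by
      have := norm_sub_norm_le (Complex.exp w) 1
      rw [Complex.norm_exp, norm_one] at this
      linarith [Real.add_one_le_exp w.re]
    have h2 : w.re ≤ ‖w‖ := Complex.re_le_norm w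
    have h3 : ‖expSubOneInvRemainder w‖ ≤ 2 / w.re := by
      rw [expSubOneInvRemainder_eq hw (by linarith)]
      refine (norm_sub_le _ _).trans ?_
      rw [norm_div, norm_div, norm_one, show 2 / w.re = 1 / w.re + 1 / w.re by ring]
      gcongr
    calc ‖expSubOneInvRemainder w‖ * (1 + (R + w.re))
        ≤ 2 / w.re * ((2 + R) * w.re) :=
          mul_le_mul h3 (by nlinarith) (by linarith) (by positivity)
      _ = 2 * (2 + R) := by field_simp

section

open MeasureTheory Set

/-! ### The cut plane -/

/-- The plane cut along `[1, ∞)`. -/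
def polylogDomain : Set ℂ := {z : ℂ | ¬ (z.im = 0 ∧ 1 ≤ z.re)}

theorem mem_polylogDomain_iff {z : ℂ} : z ∈ polylogDomain ↔ 1 - z ∈ Complex.slitPlane := by
  rw [Complex.mem_slitPlane_iff]
  simp only [polylogDomain, mem_ofPred_eq, Complex.sub_re, Complex.one_re, Complex.sub_im,
    Complex.one_im, zero_sub, ne_eq, neg_eq_zero, sub_pos]
  rw [not_and_or, not_le, or_comm]

theorem isOpen_polylogDomain : IsOpen polylogDomain := by
  have : polylogDomain = (fun z : ℂ => 1 - z) ⁻¹' Complex.slitPlane :=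
    Set.ext fun z => mem_polylogDomain_iff
  rw [this]
  exact Complex.isOpen_slitPlane.preimage (by fun_prop)

theorem real_smul_mem_polylogDomain {z : ℂ} (hz : z ∈ polylogDomain) {u : ℝ} (h0 : 0 ≤ u)
    (h1 : u ≤ 1) : z * u ∈ polylogDomain := by
  rintro ⟨him, hre⟩
  simp only [Complex.mul_im, Complex.ofReal_re, Complex.ofReal_im, mul_zero, zero_add,
    Complex.mul_re, sub_zero] at him hre
  have hu : u ≠ 0 := by rintro rfl; norm_num at hre
  have hu' : 0 < u := lt_of_le_of_ne h0 hu.symm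
  refine hz ⟨by simpa [hu] using him, ?_⟩
  nlinarith

theorem starConvex_polylogDomain : StarConvex ℝ 0 polylogDomain := by
  rw [starConvex_zero_iff]
  intro z hz u h0 h1
  rw [Complex.real_smul, mul_comm]
  exact real_smul_mem_polylogDomain hz h0 h1

theorem mem_polylogDomain_of_norm_lt_one {z : ℂ} (hz : ‖z‖ < 1) : z ∈ polylogDomain := by
  rintro ⟨-, h⟩
  linarith [Complex.re_le_norm z]

/-- Compactness of disc times [0, 1]; with u = e^(-t) this controls the denominator of the Bose
integrand locally uniformly. -/
theorem exists_le_norm_one_sub_mul {z₀ : ℂ} (hz₀ : z₀ ∈ polylogDomain) :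
    ∃ r > 0, ∃ c > 0, ∀ z ∈ Metric.ball z₀ r, ∀ u : ℝ, 0 ≤ u → u ≤ 1 → c ≤ ‖1 - z * u‖ := by
  obtain ⟨r, hr, hsub⟩ := Metric.nhds_basis_closedBall.mem_iff.1
    (isOpen_polylogDomain.mem_nhds hz₀)
  have hK : IsCompact (Metric.closedBall z₀ r ×ˢ Icc (0 : ℝ) 1) :=
    (isCompact_closedBall z₀ r).prod isCompact_Icc
  obtain ⟨⟨z₁, u₁⟩, hm, hmin⟩ := hK.exists_isMinOn
    (f := fun x : ℂ × ℝ => ‖1 - x.1 * x.2‖)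
    ⟨(z₀, 0), Metric.mem_closedBall_self hr.le, by simp⟩ (by fun_prop)
  refine ⟨r, hr, _, ?_, fun z hz u h0 h1 =>
    hmin (show (z, u) ∈ _ from ⟨Metric.ball_subset_closedBall hz, h0, h1⟩)⟩
  have := real_smul_mem_polylogDomain (hsub hm.1) hm.2.1 hm.2.2
  exact norm_pos_iff.2 (Complex.slitPlane_ne_zero (mem_polylogDomain_iff.1 this))

/-- A pair of functions such that `L` is the polylogarithm of order `s` on the plane cut along
`[1, ∞)`, and `h` is the regular part of `L (exp (-q))` at the branch point `q = 0`. -/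
structure HasPolylogExpansion (s : ℝ) (L h : ℂ → ℂ) : Prop where
  hasSum : ∀ z : ℂ, ‖z‖ < 1 →
    HasSum (fun k : ℕ => z ^ (k + 1) / ((k : ℂ) + 1) ^ (s : ℂ)) (L z)
  differentiableOn : DifferentiableOn ℂ L polylogDomain
  differentiableOn_remainder : DifferentiableOn ℂ h {q : ℂ | |q.im| < Real.pi}
  expansion : ∀ q : ℂ, |q.im| < Real.pi → q ∈ Complex.slitPlane →
    L (Complex.exp (-q)) = Real.Gamma (1 - s) * q ^ ((s : ℂ) - 1) + h q

/-! ### The Bose integral and its expansion for 0 < s < 1 -/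

theorem integrableOn_rpow_mul_div_one_add {s : ℝ} (h0 : 0 < s) (h1 : s < 1) (C : ℝ) :
    IntegrableOn (fun t : ℝ => t ^ (s - 1) * (C / (1 + t))) (Ioi 0) := by
  suffices h : IntegrableOn (fun t : ℝ => t ^ (s - 1) * (1 + t)⁻¹) (Ioi 0) by
    refine (h.const_mul C).congr (Eventually.of_forall fun t => ?_)
    simp only [div_eq_mul_inv]
    ring
  have hm : ∀ S : Set ℝ, AEStronglyMeasurable (fun t : ℝ => t ^ (s - 1) * (1 + t)⁻¹)
      (volume.restrict S) := fun S => by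
    have : Measurable (fun t : ℝ => t ^ (s - 1) * (1 + t)⁻¹) := by fun_prop
    exact this.aestronglyMeasurable
  rw [← Ioc_union_Ioi_eq_Ioi zero_le_one]
  refine IntegrableOn.union ?_ ?_
  · have hi : IntegrableOn (fun t : ℝ => t ^ (s - 1)) (Ioc 0 1) :=
      (intervalIntegrable_iff_integrableOn_Ioc_of_le zero_le_one).1
        (intervalIntegral.intervalIntegrable_rpow' (by linarith))
    refine hi.mono' (hm _) ((ae_restrict_iff' measurableSet_Ioc).2 (Eventually.of_forall ?_))
    intro t ht
    have := Real.rpow_nonneg ht.1.le (s - 1)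
    have h2 : (1 + t)⁻¹ ≤ 1 := inv_le_one_of_one_le₀ (by linarith [ht.1])
    have h3 : 0 ≤ (1 + t)⁻¹ := inv_nonneg.2 (by linarith [ht.1])
    rw [Real.norm_of_nonneg (mul_nonneg this h3)]
    exact mul_le_of_le_one_right this h2
  · have hi : IntegrableOn (fun t : ℝ => t ^ (s - 2)) (Ioi 1) :=
      integrableOn_Ioi_rpow_of_lt (by linarith) one_pos
    refine hi.mono' (hm _) ((ae_restrict_iff' measurableSet_Ioi).2 (Eventually.of_forall ?_))
    intro t ht
    have ht0 : (0 : ℝ) < t := lt_trans one_pos ht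
    have := Real.rpow_nonneg ht0.le (s - 1)
    have h3 : 0 ≤ (1 + t)⁻¹ := inv_nonneg.2 (by linarith)
    rw [Real.norm_of_nonneg (mul_nonneg this h3),
      show s - 2 = (s - 1) - 1 by ring, Real.rpow_sub_one ht0.ne' (s - 1), div_eq_mul_inv]
    gcongr
    linarith

/-- Write 1/(t + q) as the integral of exp(-(t + q)x) over x > 0 and exchange the integrals: t gives
Γ(s) x^(-s), then x gives Γ(1-s) q^(s-1). -/
theorem integral_rpow_div_add {s : ℝ} (h0 : 0 < s) (h1 : s < 1) {q : ℝ} (hq : 0 < q) :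
    IntegrableOn (fun t : ℝ => t ^ (s - 1) / (t + q)) (Ioi 0) ∧
    ∫ t in Ioi (0 : ℝ), t ^ (s - 1) / (t + q) =
      Real.Gamma s * Real.Gamma (1 - s) * q ^ (s - 1) := by
  have hint : IntegrableOn (fun t : ℝ => t ^ (s - 1) / (t + q)) (Ioi 0) := by
    have hm : Measurable (fun t : ℝ => t ^ (s - 1) / (t + q)) := by fun_prop
    refine (integrableOn_rpow_mul_div_one_add h0 h1 (1 + 1 / q)).mono'
      hm.aestronglyMeasurable
      ((ae_restrict_iff' measurableSet_Ioi).2 (Eventually.of_forall fun t ht => ?_))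
    have ht' : (0 : ℝ) < t := ht
    have hp := Real.rpow_nonneg ht'.le (s - 1)
    rw [Real.norm_of_nonneg (div_nonneg hp (by linarith)), div_eq_mul_inv]
    refine mul_le_mul_of_nonneg_left ?_ hp
    rw [inv_eq_one_div, div_le_div_iff₀ (by linarith) (by linarith)]
    have : 1 / q * q = 1 := by field_simp
    have : 0 < 1 / q * t := by positivity
    nlinarith
  refine ⟨hint, ?_⟩
  let f : ℝ → ℝ → ℝ := fun t x => t ^ (s - 1) * Real.exp (-((t + q) * x))
  have hinner : ∀ t : ℝ, 0 < t → ∫ x in Ioi (0 : ℝ), f t x = t ^ (s - 1) / (t + q) := by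
    intro t ht
    have := Real.integral_rpow_mul_exp_neg_mul_Ioi one_pos (show 0 < t + q by linarith)
    simp only [sub_self, Real.rpow_zero, one_mul, Real.rpow_one, Real.Gamma_one, mul_one] at this
    simp only [f]
    rw [integral_const_mul, this]
    ring
  have hinner' : ∀ x : ℝ, 0 < x → ∫ t in Ioi (0 : ℝ), f t x =
      Real.Gamma s * (x ^ ((1 - s) - 1) * Real.exp (-(q * x))) := by
    intro x hx
    have := Real.integral_rpow_mul_exp_neg_mul_Ioi h0 hx
    have h2 : ∀ t, f t x = t ^ (s - 1) * Real.exp (-(x * t)) * Real.exp (-(q * x)) := by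
      intro t
      simp only [f]
      rw [mul_assoc, ← Real.exp_add]
      ring_nf
    simp only [h2]
    rw [integral_mul_const, this, one_div, Real.inv_rpow hx.le, ← Real.rpow_neg hx.le]
    ring_nf
  have hpos : ∀ t x : ℝ, 0 < t → 0 ≤ f t x := fun t x ht =>
    mul_nonneg (Real.rpow_nonneg ht.le _) (Real.exp_pos _).le
  have hfm : Measurable (Function.uncurry f) := by
    simp only [f, Function.uncurry_def]
    fun_prop
  have hprod : Integrable (Function.uncurry f)
      ((volume.restrict (Ioi (0 : ℝ))).prod (volume.restrict (Ioi (0 : ℝ)))) := by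
    rw [integrable_prod_iff hfm.aestronglyMeasurable]
    constructor
    · refine (ae_restrict_iff' measurableSet_Ioi).2 (Eventually.of_forall fun t ht => ?_)
      have ht' : (0 : ℝ) < t := ht
      -- A non-integrable slice would have integral 0 by convention, but the computed value is
      -- positive.
      by_contra hcon
      have h3 : ∫ x in Ioi (0 : ℝ), f t x = 0 := integral_undef hcon
      rw [hinner t ht'] at h3
      have : 0 < t ^ (s - 1) / (t + q) := div_pos (Real.rpow_pos_of_pos ht' _) (by linarith)
      linarith
    · refine hint.congr ((ae_restrict_iff' measurableSet_Ioi).2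
        (Eventually.of_forall fun t ht => ?_))
      refine (hinner t ht).symm.trans ?_
      exact integral_congr_ae (Eventually.of_forall fun x =>
        (Real.norm_of_nonneg (hpos t x ht)).symm)
  calc ∫ t in Ioi (0 : ℝ), t ^ (s - 1) / (t + q)
      = ∫ t in Ioi (0 : ℝ), ∫ x in Ioi (0 : ℝ), f t x :=
        setIntegral_congr_fun measurableSet_Ioi fun t ht => (hinner t ht).symm
    _ = ∫ x in Ioi (0 : ℝ), ∫ t in Ioi (0 : ℝ), f t x := integral_integral_swap hprod
    _ = ∫ x in Ioi (0 : ℝ), Real.Gamma s * (x ^ ((1 - s) - 1) * Real.exp (-(q * x))) :=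
        setIntegral_congr_fun measurableSet_Ioi fun x hx => hinner' x hx
    _ = Real.Gamma s * Real.Gamma (1 - s) * q ^ (s - 1) := by
        rw [integral_const_mul, Real.integral_rpow_mul_exp_neg_mul_Ioi (by linarith) hq, one_div,
          Real.inv_rpow hq.le, ← Real.rpow_neg hq.le]
        ring_nf

/-- The Bose integral for the polylogarithm of positive order. -/
noncomputable def boseIntegral (s : ℝ) (z : ℂ) : ℂ :=
  (Real.Gamma s : ℂ)⁻¹ * ∫ t in Ioi (0 : ℝ), ((t ^ (s - 1) : ℝ) : ℂ) *
    (z * ((Real.exp (-t) : ℝ) : ℂ) / (1 - z * ((Real.exp (-t) : ℝ) : ℂ)))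

/-- The regular part of the Bose integral at its branch point. -/
noncomputable def boseRemainder (s : ℝ) (q : ℂ) : ℂ :=
  (Real.Gamma s : ℂ)⁻¹ * ∫ t in Ioi (0 : ℝ), ((t ^ (s - 1) : ℝ) : ℂ) *
    expSubOneInvRemainder (t + q)

theorem differentiableOn_boseIntegral {s : ℝ} (h0 : 0 < s) :
    DifferentiableOn ℂ (boseIntegral s) polylogDomain := by
  intro z₀ hz₀
  obtain ⟨r, hr, c, hc, hle⟩ := exists_le_norm_one_sub_mul hz₀
  refine DifferentiableAt.differentiableWithinAt (DifferentiableAt.const_mul ?_ _)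
  refine differentiableAt_integral_of_dominated hr
    (bound := fun t => (‖z₀‖ + r) / c * (Real.exp (-t) * t ^ (s - 1))) ?_ ?_
    ((Real.GammaIntegral_convergent h0).const_mul _) ?_
  · intro z _
    have : Measurable fun t : ℝ => ((t ^ (s - 1) : ℝ) : ℂ) *
      (z * ((Real.exp (-t) : ℝ) : ℂ) / (1 - z * ((Real.exp (-t) : ℝ) : ℂ))) := by fun_prop
    exact this.aestronglyMeasurable
  · refine (ae_restrict_iff' measurableSet_Ioi).2 (Eventually.of_forall fun t ht z hz => ?_)
    have ht' : (0 : ℝ) < t := ht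
    have h1 := hle z hz (Real.exp (-t)) (Real.exp_pos _).le (Real.exp_le_one_iff.2 (by linarith))
    have h2 : ‖z‖ ≤ ‖z₀‖ + r := by
      have h3 : ‖z - z₀‖ < r := mem_ball_iff_norm.1 hz
      have := norm_add_le z₀ (z - z₀)
      rw [add_sub_cancel] at this
      linarith
    have hp := Real.rpow_nonneg ht'.le (s - 1)
    rw [norm_mul, norm_div, norm_mul, Complex.norm_real, Complex.norm_real,
      Real.norm_of_nonneg hp, Real.norm_of_nonneg (Real.exp_pos _).le]
    calc t ^ (s - 1) * (‖z‖ * Real.exp (-t) / ‖1 - z * (Real.exp (-t) : ℝ)‖)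
        ≤ t ^ (s - 1) * ((‖z₀‖ + r) * Real.exp (-t) / c) := by gcongr
      _ = (‖z₀‖ + r) / c * (Real.exp (-t) * t ^ (s - 1)) := by ring
  · refine (ae_restrict_iff' measurableSet_Ioi).2 (Eventually.of_forall fun t ht z hz => ?_)
    have ht' : (0 : ℝ) < t := ht
    have h1 := hle z hz (Real.exp (-t)) (Real.exp_pos _).le (Real.exp_le_one_iff.2 (by linarith))
    have h2 : 1 - z * ((Real.exp (-t) : ℝ) : ℂ) ≠ 0 := norm_pos_iff.1 (hc.trans_le h1)
    refine DifferentiableAt.differentiableWithinAt ?_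
    fun_prop (disch := exact h2)

theorem aestronglyMeasurable_boseRemainder_integrand (s : ℝ) {q : ℂ} (hq : |q.im| < Real.pi) :
    AEStronglyMeasurable (fun t : ℝ => ((t ^ (s - 1) : ℝ) : ℂ) * expSubOneInvRemainder (t + q))
      (volume.restrict (Ioi 0)) := by
  refine ContinuousOn.aestronglyMeasurable ?_ measurableSet_Ioi
  refine ContinuousOn.mul ?_ ?_
  · refine Complex.continuous_ofReal.comp_continuousOn ?_
    exact fun t ht => (Real.continuousAt_rpow_const t _ (Or.inl ht.out.ne')).continuousWithinAt
  · refine differentiableOn_expSubOneInvRemainder.continuousOn.comp (by fun_prop) fun t _ => ?_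
    simp only [mem_ofPred_eq, Complex.add_im, Complex.ofReal_im, zero_add]
    linarith [Real.pi_pos]

theorem norm_boseRemainder_integrand_le (s : ℝ) {R C : ℝ} (hC : ∀ w : ℂ, -R ≤ w.re →
    |w.im| ≤ Real.pi → ‖expSubOneInvRemainder w‖ ≤ C / (1 + (R + w.re))) {q : ℂ}
    (hq : |q.im| < Real.pi) (hR : -R ≤ q.re) {t : ℝ} (ht : 0 < t) (hC0 : 0 ≤ C) :
    ‖((t ^ (s - 1) : ℝ) : ℂ) * expSubOneInvRemainder (t + q)‖ ≤ t ^ (s - 1) * (C / (1 + t)) := by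
  have hp := Real.rpow_nonneg ht.le (s - 1)
  rw [norm_mul, Complex.norm_real, Real.norm_of_nonneg hp]
  refine mul_le_mul_of_nonneg_left ?_ hp
  have := hC (t + q) (by simp; linarith) (by simpa using hq.le)
  refine this.trans ?_
  simp only [Complex.add_re, Complex.ofReal_re]
  gcongr
  linarith

theorem exists_bound_expSubOneInvRemainder (R : ℝ) (hR : 0 ≤ R) :
    ∃ C : ℝ, 0 ≤ C ∧ ∀ w : ℂ, -R ≤ w.re → |w.im| ≤ Real.pi →
      ‖expSubOneInvRemainder w‖ ≤ C / (1 + (R + w.re)) := by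
  obtain ⟨C, hC⟩ := exists_norm_expSubOneInvRemainder_le R hR
  refine ⟨C, ?_, hC⟩
  have := (norm_nonneg _).trans (hC 0 (by simpa using hR) (by simpa using Real.pi_pos.le))
  rcases (div_nonneg_iff.1 this) with h | h
  · exact h.1
  · simp at h; linarith

theorem integrableOn_boseRemainder_integrand {s : ℝ} (h0 : 0 < s) (h1 : s < 1) {q : ℂ}
    (hq : |q.im| < Real.pi) :
    IntegrableOn (fun t : ℝ => ((t ^ (s - 1) : ℝ) : ℂ) * expSubOneInvRemainder (t + q))
      (Ioi 0) := by
  obtain ⟨C, hC0, hC⟩ := exists_bound_expSubOneInvRemainder |q.re| (abs_nonneg _)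
  exact (integrableOn_rpow_mul_div_one_add h0 h1 C).mono'
    (aestronglyMeasurable_boseRemainder_integrand s hq)
    ((ae_restrict_iff' measurableSet_Ioi).2 (Eventually.of_forall fun t ht =>
      norm_boseRemainder_integrand_le s hC hq (neg_abs_le _) ht hC0))

theorem isOpen_strip : IsOpen {q : ℂ | |q.im| < Real.pi} :=
  isOpen_lt (by fun_prop) continuous_const

theorem differentiableOn_boseRemainder {s : ℝ} (h0 : 0 < s) (h1 : s < 1) :
    DifferentiableOn ℂ (boseRemainder s) {q : ℂ | |q.im| < Real.pi} := by
  intro q₀ hq₀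
  obtain ⟨r, hr, hsub⟩ := Metric.isOpen_iff.1 isOpen_strip q₀ hq₀
  obtain ⟨C, hC0, hC⟩ := exists_bound_expSubOneInvRemainder (|q₀.re| + r) (by positivity)
  refine DifferentiableAt.differentiableWithinAt (DifferentiableAt.const_mul ?_ _)
  refine differentiableAt_integral_of_dominated hr
    (fun q hq => aestronglyMeasurable_boseRemainder_integrand s (hsub hq)) ?_
    (integrableOn_rpow_mul_div_one_add h0 h1 C) ?_
  · refine (ae_restrict_iff' measurableSet_Ioi).2 (Eventually.of_forall fun t ht q hq => ?_)
    refine norm_boseRemainder_integrand_le s hC (hsub hq) ?_ ht hC0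
    have h3 : ‖q - q₀‖ < r := mem_ball_iff_norm.1 hq
    have h4 := (Complex.abs_re_le_norm (q - q₀)).trans_lt h3
    rw [Complex.sub_re] at h4
    linarith [(abs_lt.1 h4).1, neg_abs_le q₀.re]
  · refine Eventually.of_forall fun t => DifferentiableOn.const_mul ?_ _
    refine differentiableOn_expSubOneInvRemainder.comp (by fun_prop) fun q hq => ?_
    have : |q.im| < Real.pi := hsub hq
    simp only [mem_ofPred_eq, Complex.add_im, Complex.ofReal_im, zero_add]
    linarith [Real.pi_pos]

/-- Expand the integrand as a geometric series in z e^(-t) and take Mellin transforms termwise. -/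
theorem hasSum_boseIntegral {s : ℝ} (h0 : 0 < s) {z : ℂ} (hz : ‖z‖ < 1) :
    HasSum (fun k : ℕ => z ^ (k + 1) / ((k : ℂ) + 1) ^ (s : ℂ)) (boseIntegral s z) := by
  have hG : (Real.Gamma s : ℂ) ≠ 0 := Complex.ofReal_ne_zero.2 (Real.Gamma_pos_of_pos h0).ne'
  have key := hasSum_mellin (ι := ℕ) (a := fun k => z ^ (k + 1)) (p := fun k => (k : ℝ) + 1)
    (F := fun t => z * ((Real.exp (-t) : ℝ) : ℂ) / (1 - z * ((Real.exp (-t) : ℝ) : ℂ)))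
    (s := (s : ℂ)) (fun k => Or.inr (by positivity)) (by simpa using h0) ?_ ?_
  · convert! key.mul_left (Real.Gamma s : ℂ)⁻¹ using 1
    · ext k
      rw [Complex.Gamma_ofReal]
      push_cast
      field_simp
    · rw [boseIntegral, mellin]
      congr 1
      refine setIntegral_congr_fun measurableSet_Ioi fun t ht => ?_
      simp only [smul_eq_mul]
      rw [Complex.ofReal_cpow (le_of_lt ht)]
      push_cast
      rfl
  · intro t ht
    have ht' : (0 : ℝ) < t := ht
    have hlt : ‖z * ((Real.exp (-t) : ℝ) : ℂ)‖ < 1 := by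
      rw [norm_mul, Complex.norm_real, Real.norm_of_nonneg (Real.exp_pos _).le]
      have : Real.exp (-t) ≤ 1 := Real.exp_le_one_iff.2 (by linarith)
      exact (mul_le_of_le_one_right (norm_nonneg _) this).trans_lt hz
    convert! (hasSum_geometric_of_norm_lt_one hlt).mul_left (z * ((Real.exp (-t) : ℝ) : ℂ)) using 1
    ext k
    rw [← pow_succ', mul_pow, ← Complex.ofReal_pow, ← Real.exp_nat_mul]
    push_cast
    ring_nf
  · refine Summable.of_nonneg_of_le (fun k => by positivity) (fun k => ?_)
      ((summable_geometric_of_lt_one (norm_nonneg _) hz).mul_left ‖z‖)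
    rw [norm_pow, ← pow_succ']
    refine div_le_self (by positivity) ?_
    exact Real.one_le_rpow (by simp) (by simpa using h0.le)

theorem isPreconnected_slitStrip :
    IsPreconnected ({q : ℂ | |q.im| < Real.pi} ∩ Complex.slitPlane) := by
  have hconv : Convex ℝ {q : ℂ | |q.im| < Real.pi} := by
    have : {q : ℂ | |q.im| < Real.pi} = Complex.imLm ⁻¹' Ioo (-Real.pi) Real.pi := by
      ext q
      simp [abs_lt]
    rw [this]
    exact (convex_Ioo _ _).linear_preimage _
  have h1 : (1 : ℂ) ∈ {q : ℂ | |q.im| < Real.pi} := by simp [Real.pi_pos]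
  have hstar : StarConvex ℝ 1 ({q : ℂ | |q.im| < Real.pi} ∩ Complex.slitPlane) :=
    (hconv.starConvex h1).inter Complex.starConvex_one_slitPlane
  exact (hstar.isPathConnected ⟨h1, Complex.one_mem_slitPlane⟩).isConnected.isPreconnected

/-- In the strip log(exp(-q)) = -q, so a value in [1, ∞) would force q to be real and nonpositive.
-/
theorem exp_neg_mem_polylogDomain {q : ℂ} (hq : |q.im| < Real.pi) (hq' : q ∈ Complex.slitPlane) :
    Complex.exp (-q) ∈ polylogDomain := by
  rintro ⟨him, hre⟩
  have h0 : Complex.exp (-q) = ((Complex.exp (-q)).re : ℂ) := Complex.ext rfl (by simpa using him)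
  have h1 : Complex.log (Complex.exp (-q)) = -q := by
    have := abs_lt.1 hq
    exact Complex.log_exp (by simp; linarith) (by simp; linarith)
  rw [h0, ← Complex.ofReal_log (by linarith)] at h1
  have h2 := congrArg Complex.re h1
  have h3 := congrArg Complex.im h1
  simp only [Complex.ofReal_re, Complex.neg_re, Complex.ofReal_im, Complex.neg_im] at h2 h3
  have := Real.log_nonneg hre
  rcases Complex.mem_slitPlane_iff.1 hq' with h | h
  · linarith
  · exact h (by linarith)

theorem boseIntegral_exp_neg_ofReal {s : ℝ} (h0 : 0 < s) (h1 : s < 1) {q : ℝ} (hq : 0 < q) :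
    boseIntegral s (Complex.exp (-q)) =
      Real.Gamma (1 - s) * (q : ℂ) ^ ((s : ℂ) - 1) + boseRemainder s q := by
  obtain ⟨hi, hv⟩ := integral_rpow_div_add h0 h1 hq
  have hG : (Real.Gamma s : ℂ) ≠ 0 := Complex.ofReal_ne_zero.2 (Real.Gamma_pos_of_pos h0).ne'
  have hint := integrableOn_boseRemainder_integrand h0 h1 (q := (q : ℂ)) (by simp [Real.pi_pos])
  have hsplit : ∫ t in Ioi (0 : ℝ), ((t ^ (s - 1) : ℝ) : ℂ) *
      (Complex.exp (-q) * ((Real.exp (-t) : ℝ) : ℂ) /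
        (1 - Complex.exp (-q) * ((Real.exp (-t) : ℝ) : ℂ))) =
      ∫ t in Ioi (0 : ℝ), (((t ^ (s - 1) / (t + q) : ℝ) : ℂ) +
        ((t ^ (s - 1) : ℝ) : ℂ) * expSubOneInvRemainder (t + q)) := by
    refine setIntegral_congr_fun measurableSet_Ioi fun t ht => ?_
    have ht' : (0 : ℝ) < t := ht
    have hne : (t + q : ℂ) ≠ 0 := by
      rw [← Complex.ofReal_add]
      exact Complex.ofReal_ne_zero.2 (by linarith)
    have him : |(t + q : ℂ).im| < 2 * Real.pi := by simp [Real.pi_pos]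
    have hexp := sub_ne_zero.2 (exp_ne_one_of_abs_im_lt hne him)
    rw [expSubOneInvRemainder_eq hne him, Complex.ofReal_exp, ← Complex.exp_add,
      show -(q : ℂ) + ((-t : ℝ) : ℂ) = -(t + q) by push_cast; ring, Complex.exp_neg]
    have hE := Complex.exp_ne_zero (t + q : ℂ)
    have : (Complex.exp (t + q : ℂ))⁻¹ / (1 - (Complex.exp (t + q : ℂ))⁻¹) =
        1 / (Complex.exp (t + q : ℂ) - 1) := by
      rw [show 1 - (Complex.exp (t + q : ℂ))⁻¹ =
        (Complex.exp (t + q : ℂ) - 1) * (Complex.exp (t + q : ℂ))⁻¹ by field_simp]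
      field_simp
    rw [this]
    push_cast
    ring
  have hi' : IntegrableOn (fun t : ℝ => ((t ^ (s - 1) / (t + q) : ℝ) : ℂ)) (Ioi 0) := hi.ofReal
  rw [boseIntegral, hsplit, integral_add hi' hint, integral_complex_ofReal, hv, mul_add,
    boseRemainder]
  congr 1
  push_cast
  rw [Complex.ofReal_cpow hq.le]
  push_cast
  field_simp

theorem hasPolylogExpansion_boseIntegral {s : ℝ} (h0 : 0 < s) (h1 : s < 1) :
    HasPolylogExpansion s (boseIntegral s) (boseRemainder s) where
  hasSum z hz := hasSum_boseIntegral h0 hz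
  differentiableOn := differentiableOn_boseIntegral h0
  differentiableOn_remainder := differentiableOn_boseRemainder h0 h1
  expansion q hq hq' := by
    have hopen : IsOpen ({q : ℂ | |q.im| < Real.pi} ∩ Complex.slitPlane) :=
      isOpen_strip.inter Complex.isOpen_slitPlane
    have hf : DifferentiableOn ℂ (fun q => boseIntegral s (Complex.exp (-q)))
        ({q : ℂ | |q.im| < Real.pi} ∩ Complex.slitPlane) :=
      (differentiableOn_boseIntegral h0).comp (by fun_prop)
        fun q hq => exp_neg_mem_polylogDomain hq.1 hq.2
    have hg : DifferentiableOn ℂ (fun q : ℂ =>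
        Real.Gamma (1 - s) * q ^ ((s : ℂ) - 1) + boseRemainder s q)
        ({q : ℂ | |q.im| < Real.pi} ∩ Complex.slitPlane) := by
      refine DifferentiableOn.add (DifferentiableOn.const_mul ?_ _)
        ((differentiableOn_boseRemainder h0 h1).mono inter_subset_left)
      exact fun q hq => (differentiableAt_id.cpow_const hq.2).differentiableWithinAt
    -- Identity theorem: the two sides agree at positive reals, which accumulate at 1.
    refine (hf.analyticOnNhd hopen).eqOn_of_preconnected_of_frequently_eq (hg.analyticOnNhd hopen)
      isPreconnected_slitStrip (z₀ := 1) ⟨by simp [Real.pi_pos], Complex.one_mem_slitPlane⟩ ?_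
      ⟨hq, hq'⟩
    have hlim : Tendsto (fun x : ℝ => (x : ℂ)) (𝓝[≠] 1) (𝓝[≠] 1) := by
      refine tendsto_nhdsWithin_iff.2 ⟨?_, ?_⟩
      · exact (Complex.continuous_ofReal.tendsto' 1 1 Complex.ofReal_one).mono_left
          nhdsWithin_le_nhds
      · filter_upwards [self_mem_nhdsWithin] with x hx
        simpa using hx
    refine hlim.frequently (Eventually.frequently ?_)
    filter_upwards [nhdsWithin_le_nhds (lt_mem_nhds (zero_lt_one' ℝ))] with x hx
    exact boseIntegral_exp_neg_ofReal h0 h1 hx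

/-! ### Order zero and descent in s -/

theorem hasPolylogExpansion_zero :
    HasPolylogExpansion 0 (fun z => z / (1 - z)) expSubOneInvRemainder where
  hasSum z hz := by
    convert! (hasSum_geometric_of_norm_lt_one hz).mul_left z using 1
    ext k
    simp [pow_succ']
  differentiableOn := by
    intro z hz
    have : 1 - z ≠ 0 := Complex.slitPlane_ne_zero (mem_polylogDomain_iff.1 hz)
    refine DifferentiableAt.differentiableWithinAt ?_
    fun_prop (disch := exact this)
  differentiableOn_remainder := differentiableOn_expSubOneInvRemainder.mono fun q hq => by
    simp only [mem_ofPred_eq] at hq ⊢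
    linarith [Real.pi_pos]
  expansion q hq hq' := by
    have h0 := Complex.slitPlane_ne_zero hq'
    have him : |q.im| < 2 * Real.pi := by linarith [Real.pi_pos]
    have h1 := sub_ne_zero.2 (exp_ne_one_of_abs_im_lt h0 him)
    have h2 := Complex.exp_ne_zero q
    rw [expSubOneInvRemainder_eq h0 him]
    simp only [sub_zero, Real.Gamma_one, Complex.ofReal_one, Complex.ofReal_zero, zero_sub,
      Complex.cpow_neg_one, one_mul, Complex.exp_neg]
    rw [show 1 - (Complex.exp q)⁻¹ = (Complex.exp q - 1) * (Complex.exp q)⁻¹ by field_simp]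
    field_simp
    ring

theorem HasPolylogExpansion.hasSum_deriv {s : ℝ} {L h : ℂ → ℂ} (H : HasPolylogExpansion s L h)
    {z : ℂ} (hz : ‖z‖ < 1) :
    HasSum (fun k : ℕ => z ^ (k + 1) / ((k : ℂ) + 1) ^ ((s - 1 : ℝ) : ℂ)) (z * deriv L z) := by
  obtain ⟨r, hr, hr1⟩ := exists_between hz
  have hr0 : 0 < r := (norm_nonneg z).trans_lt hr
  have hrn : ‖(r : ℂ)‖ = r := by rw [Complex.norm_real, Real.norm_of_nonneg hr0.le]
  have hU : z ∈ Metric.ball (0 : ℂ) r := by simpa using hr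
  have key := Complex.hasSum_deriv_of_summable_norm (ι := ℕ) (U := Metric.ball (0 : ℂ) r)
    (F := fun k w => w ^ (k + 1) / ((k : ℂ) + 1) ^ (s : ℂ))
    (H.hasSum r (by rwa [hrn])).summable.norm (fun k => by fun_prop) Metric.isOpen_ball
    (fun k w hw => by
      have hw' : ‖w‖ ≤ r := by simpa using (Metric.mem_ball.1 hw).le
      rw [norm_div, norm_div, norm_pow, norm_pow, hrn]
      gcongr) hU
  have heq : (fun w : ℂ => ∑' k : ℕ, w ^ (k + 1) / ((k : ℂ) + 1) ^ (s : ℂ)) =ᶠ[𝓝 z] L := by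
    filter_upwards [Metric.isOpen_ball.mem_nhds hU] with w hw
    have hw' : ‖w‖ < r := by simpa using hw
    exact (H.hasSum w (hw'.trans hr1)).tsum_eq
  rw [heq.deriv_eq] at key
  convert! key.mul_left z using 1
  ext k
  have hk : (k : ℂ) + 1 ≠ 0 := Nat.cast_add_one_ne_zero k
  have hk' : ((k : ℂ) + 1) ^ (s : ℂ) ≠ 0 := by simp [Complex.cpow_eq_zero_iff, hk]
  rw [deriv_div_const, deriv_pow_field, Complex.ofReal_sub, Complex.ofReal_one,
    Complex.cpow_sub _ _ hk, Complex.cpow_one, pow_succ]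
  push_cast
  field_simp

/-- Differentiating the expansion in q multiplies its coefficient by 1 - s up to sign, and (1-s)
Γ(1-s) = Γ(2-s) is the coefficient for order s - 1. -/
theorem HasPolylogExpansion.derivative {s : ℝ} {L h : ℂ → ℂ} (H : HasPolylogExpansion s L h)
    (hs : s < 1) :
    HasPolylogExpansion (s - 1) (fun z => z * deriv L z) (fun q => -deriv h q) where
  hasSum z hz := H.hasSum_deriv hz
  differentiableOn := differentiableOn_id.mul (H.differentiableOn.deriv isOpen_polylogDomain)
  differentiableOn_remainder := (H.differentiableOn_remainder.deriv isOpen_strip).neg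
  expansion q hq hq' := by
    have heq : (fun q => L (Complex.exp (-q))) =ᶠ[𝓝 q]
        fun q => Real.Gamma (1 - s) * q ^ ((s : ℂ) - 1) + h q := by
      filter_upwards [isOpen_strip.mem_nhds hq, Complex.isOpen_slitPlane.mem_nhds hq']
        with w hw hw' using H.expansion w hw hw'
    have hL : HasDerivAt L (deriv L (Complex.exp (-q))) (Complex.exp (-q)) :=
      (H.differentiableOn.differentiableAt
        (isOpen_polylogDomain.mem_nhds (exp_neg_mem_polylogDomain hq hq'))).hasDerivAt
    have h1 : HasDerivAt (fun q => L (Complex.exp (-q)))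
        (deriv L (Complex.exp (-q)) * (Complex.exp (-q) * -1)) q :=
      hL.comp q (hasDerivAt_neg q).cexp
    have hh : HasDerivAt h (deriv h q) q :=
      (H.differentiableOn_remainder.differentiableAt (isOpen_strip.mem_nhds hq)).hasDerivAt
    have h2 := (((hasDerivAt_id q).cpow_const (c := (s : ℂ) - 1) hq').const_mul
      (Real.Gamma (1 - s) : ℂ)).add hh
    have h3 := (heq.hasDerivAt_iff.1 h1).unique h2
    have hG : Real.Gamma (1 - (s - 1)) = (1 - s) * Real.Gamma (1 - s) := by
      rw [← Real.Gamma_add_one (by linarith)]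
      ring_nf
    simp only [id] at h3
    rw [hG]
    push_cast
    linear_combination -h3

theorem exists_hasPolylogExpansion {s : ℝ} (hs : s < 1) :
    ∃ L h : ℂ → ℂ, HasPolylogExpansion s L h := by
  have key : ∀ n : ℕ, ∀ s : ℝ, s < 1 → 0 ≤ s + n → s + n < 1 →
      ∃ L h : ℂ → ℂ, HasPolylogExpansion s L h := by
    intro n
    induction n with
    | zero =>
      intro s hs h0 _
      rw [Nat.cast_zero, add_zero] at h0
      rcases h0.eq_or_lt with rfl | h0
      · exact ⟨_, _, hasPolylogExpansion_zero⟩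
      · exact ⟨_, _, hasPolylogExpansion_boseIntegral h0 hs⟩
    | succ n ih =>
      intro s _ h0 h1
      push_cast at h0 h1
      have hn : (0 : ℝ) ≤ n := n.cast_nonneg
      obtain ⟨L, h, H⟩ := ih (s + 1) (by linarith) (by linarith) (by linarith)
      have := H.derivative (by linarith)
      rw [add_sub_cancel_right] at this
      exact ⟨_, _, this⟩
  -- This shift brings s into [0, 1); the natural ceiling is 0 when s is already there.
  refine key ⌈-s⌉₊ s hs (by linarith [Nat.le_ceil (-s)]) ?_
  rcases le_total 0 s with h | h
  · rw [Nat.ceil_eq_zero.2 (by linarith)]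
    simpa using hs
  · linarith [Nat.ceil_lt_add_one (show 0 ≤ -s by linarith)]

/-! ### Boundary values and the principal branch -/

/-- Below the cut, -log z has positive imaginary part. The principal power is continuous up to the
negative axis from that side, so the limit is the expansion evaluated on the axis. -/
theorem HasPolylogExpansion.tendsto_boundary {s : ℝ} {L h : ℂ → ℂ}
    (H : HasPolylogExpansion s L h) {x : ℝ} (hx : 1 < x) :
    Tendsto L (𝓝[{z : ℂ | z.im < 0}] (x : ℂ))
      (𝓝 (Real.Gamma (1 - s) * (-Complex.log x) ^ ((s : ℂ) - 1) + h (-Complex.log x))) := by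
  have hx0 : 0 < x := one_pos.trans hx
  have hlog : 0 < Real.log x := Real.log_pos hx
  have hlogx : Complex.log x = (Real.log x : ℂ) := (Complex.ofReal_log hx0.le).symm
  have hne : -Complex.log x ≠ 0 := by
    rw [hlogx, neg_ne_zero]
    exact Complex.ofReal_ne_zero.2 hlog.ne'
  have hcont : Tendsto (fun z => -Complex.log z) (𝓝[{z : ℂ | z.im < 0}] (x : ℂ))
      (𝓝[{q : ℂ | 0 ≤ q.im}] (-Complex.log x)) := by
    refine tendsto_nhdsWithin_iff.2 ⟨?_, ?_⟩
    · exact ((Complex.differentiableAt_log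
        (Complex.ofReal_mem_slitPlane.2 hx0)).continuousAt.neg.tendsto).mono_left
        nhdsWithin_le_nhds
    · filter_upwards [self_mem_nhdsWithin] with z hz
      simpa [Complex.log_im] using (Complex.arg_neg_iff.2 hz).le
  have hpow : ContinuousWithinAt (fun q : ℂ => q ^ ((s : ℂ) - 1)) {q : ℂ | 0 ≤ q.im}
      (-Complex.log x) := by
    have h1 : ContinuousWithinAt Complex.log {q : ℂ | 0 ≤ q.im} (-Complex.log x) :=
      Complex.continuousWithinAt_log_of_re_neg_of_im_zero
        (by rw [hlogx]; simpa using hlog) (by rw [hlogx]; simp)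
    have h2 : ContinuousWithinAt (fun q => Complex.exp (Complex.log q * ((s : ℂ) - 1)))
        {q : ℂ | 0 ≤ q.im} (-Complex.log x) := (h1.mul_const _).cexp
    refine h2.congr_of_eventuallyEq ?_ (Complex.cpow_def_of_ne_zero hne _)
    filter_upwards [nhdsWithin_le_nhds (isOpen_ne.mem_nhds hne)] with q hq
      using Complex.cpow_def_of_ne_zero hq _
  have hh : ContinuousAt h (-Complex.log x) :=
    (H.differentiableOn_remainder.differentiableAt (isOpen_strip.mem_nhds (by
      rw [hlogx]
      simp [Real.pi_pos]))).continuousAt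
  have hlim := ((hpow.const_mul (Real.Gamma (1 - s) : ℂ)).add
    hh.continuousWithinAt).tendsto.comp hcont
  refine hlim.congr' ?_
  filter_upwards [self_mem_nhdsWithin] with z hz
  have hz0 : z ≠ 0 := by rintro rfl; simp at hz
  have harg := Complex.arg_neg_iff.2 hz
  have harg' := Complex.neg_pi_lt_arg z
  have h1 := H.expansion (-Complex.log z)
    (by rw [abs_lt, Complex.neg_im, Complex.log_im]; constructor <;> linarith)
    (Complex.mem_slitPlane_iff.2 (Or.inr (by
      rw [Complex.neg_im, Complex.log_im]
      exact neg_ne_zero.2 harg.ne)))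
  rw [neg_neg, Complex.exp_log hz0] at h1
  exact h1.symm

theorem neBot_nhdsWithin_im_neg (x : ℝ) : (𝓝[{z : ℂ | z.im < 0}] (x : ℂ)).NeBot := by
  rw [← mem_closure_iff_nhdsWithin_neBot, Complex.closure_setOfPred_im_lt]
  simp

theorem mem_polylogDomain_of_im_ne_zero {z : ℂ} (hz : z.im ≠ 0) : z ∈ polylogDomain :=
  fun h => hz h.1

/-- A witness is glued from L off the cut and its lower boundary values on it; the choice in
`polylog` then inherits the properties. -/
theorem isPolylog_polylog {s : ℝ} (hs : s < 1) : IsPolylog s (polylog s) := by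
  classical
  obtain ⟨L, h, H⟩ := exists_hasPolylogExpansion hs
  let M : ℂ → ℂ := fun z => if z ∈ polylogDomain then L z else
    Real.Gamma (1 - s) * (-Complex.log z) ^ ((s : ℂ) - 1) + h (-Complex.log z)
  have hM : EqOn M L polylogDomain := fun z hz => if_pos hz
  have hex : ∃ M, IsPolylog s M := by
    refine ⟨M, ⟨fun z hz => ?_, ?_, fun x hx => ?_⟩⟩
    · rw [hM (mem_polylogDomain_of_norm_lt_one hz)]
      exact H.hasSum z hz
    · exact (H.differentiableOn.congr hM).analyticOnNhd isOpen_polylogDomain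
    · have hx' : (x : ℂ) ∉ polylogDomain := fun hcon => hcon ⟨by simp, by simpa using hx.le⟩
      have h1 : M x = _ := if_neg hx'
      rw [h1]
      refine (H.tendsto_boundary hx).congr' ?_
      filter_upwards [self_mem_nhdsWithin] with z hz
      exact (hM (mem_polylogDomain_of_im_ne_zero (ne_of_lt hz))).symm
  rw [polylog, dif_pos hex]
  exact hex.choose_spec

theorem isPreconnected_polylogDomain : IsPreconnected polylogDomain :=
  (starConvex_polylogDomain.isPathConnected
    (mem_polylogDomain_of_norm_lt_one (by simp))).isConnected.isPreconnected

theorem IsPolylog.eqOn_polylogDomain {s : ℂ} {L M : ℂ → ℂ} (hL : IsPolylog s L)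
    (hM : ∀ z : ℂ, ‖z‖ < 1 →
      HasSum (fun k : ℕ => z ^ (k + 1) / ((k : ℂ) + 1) ^ s) (M z))
    (hM' : DifferentiableOn ℂ M polylogDomain) : EqOn L M polylogDomain := by
  refine hL.analytic.eqOn_of_preconnected_of_eventuallyEq
    (hM'.analyticOnNhd isOpen_polylogDomain) isPreconnected_polylogDomain (z₀ := 0)
    (mem_polylogDomain_of_norm_lt_one (by simp)) ?_
  filter_upwards [Metric.ball_mem_nhds (0 : ℂ) one_pos] with z hz
  have hz' : ‖z‖ < 1 := by simpa using hz
  exact (hL.hasSum z hz').unique (hM z hz')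

/-- The expansion of the polylogarithm at its branch point, valid on both sides of the cut and
on the cut itself. -/
theorem exists_polylog_exp_neg_eq {s : ℝ} (hs : s < 1) :
    ∃ h : ℂ → ℂ, ContinuousAt h 0 ∧ ∀ q : ℂ, q ≠ 0 → |q.im| < Real.pi →
      polylog s (Complex.exp (-q)) = Real.Gamma (1 - s) * q ^ ((s : ℂ) - 1) + h q := by
  obtain ⟨L, h, H⟩ := exists_hasPolylogExpansion hs
  have P := isPolylog_polylog hs
  have heq := P.eqOn_polylogDomain H.hasSum H.differentiableOn
  refine ⟨h, (H.differentiableOn_remainder.differentiableAt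
    (isOpen_strip.mem_nhds (by simp [Real.pi_pos]))).continuousAt, fun q hq hq' => ?_⟩
  by_cases hslit : q ∈ Complex.slitPlane
  · rw [heq (exp_neg_mem_polylogDomain hq' hslit)]
    exact H.expansion q hq' hslit
  -- What remains is q < 0, where exp(-q) lies on the cut: both sides are the limit from below.
  · rw [Complex.mem_slitPlane_iff, not_or, not_lt, not_not] at hslit
    have hqre : q = (q.re : ℂ) := Complex.ext rfl (by simpa using hslit.2)
    have hneg : q.re < 0 := lt_of_le_of_ne hslit.1 fun h0 => hq (by rw [hqre, h0]; simp)
    have hx : 1 < Real.exp (-q.re) := Real.one_lt_exp_iff.2 (by linarith)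
    have hexp : Complex.exp (-q) = (Real.exp (-q.re) : ℂ) := by
      rw [hqre]
      push_cast
      simp
    have hlog : -Complex.log (Real.exp (-q.re) : ℂ) = q := by
      rw [← Complex.ofReal_log (Real.exp_pos _).le, Real.log_exp, hqre]
      simp
    have hlim := H.tendsto_boundary hx
    rw [hlog] at hlim
    have := neBot_nhdsWithin_im_neg (Real.exp (-q.re))
    rw [hexp]
    refine tendsto_nhds_unique ((P.boundary _ hx).congr' ?_) hlim
    filter_upwards [self_mem_nhdsWithin] with z hz
    exact heq (mem_polylogDomain_of_im_ne_zero (ne_of_lt hz))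

/-! ### The duplication formula -/

theorem sq_mem_polylogDomain {z : ℂ} (h1 : z ∈ polylogDomain) (h2 : -z ∈ polylogDomain) :
    z ^ 2 ∈ polylogDomain := by
  rintro ⟨him, hre⟩
  have h3 : (z ^ 2).im = 2 * (z.re * z.im) := by rw [sq, Complex.mul_im]; ring
  have h4 : (z ^ 2).re = z.re ^ 2 - z.im ^ 2 := by rw [sq, Complex.mul_re]; ring
  rw [h3] at him
  rw [h4] at hre
  have h5 : z.re ≠ 0 := by
    intro h0
    rw [h0] at hre
    nlinarith [sq_nonneg z.im]
  have h6 : z.im = 0 := by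
    rcases mul_eq_zero.1 ((mul_eq_zero.1 him).resolve_left two_ne_zero) with h | h
    · exact absurd h h5
    · exact h
  rw [h6] at hre
  rcases le_or_gt 1 z.re with h | h
  · exact h1 ⟨h6, h⟩
  · refine h2 ⟨by simp [h6], ?_⟩
    rw [Complex.neg_re]
    by_contra! hcon
    nlinarith

theorem IsPolylog.add_neg_of_norm_lt_one {s : ℂ} {L : ℂ → ℂ} (H : IsPolylog s L) {z : ℂ}
    (hz : ‖z‖ < 1) : L z + L (-z) = 2 ^ (1 - s) * L (z ^ 2) := by
  have h1 := (H.hasSum z hz).add (H.hasSum (-z) (by rwa [norm_neg]))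
  have hz2 : ‖z ^ 2‖ < 1 := by
    rw [norm_pow]
    exact pow_lt_one₀ (norm_nonneg z) hz two_ne_zero
  have h2 := (H.hasSum (z ^ 2) hz2).mul_left ((2 : ℂ) ^ (1 - s))
  refine h1.unique ?_
  rw [← zero_add ((2 : ℂ) ^ (1 - s) * L (z ^ 2))]
  -- Index k carries the power k + 1, so even indices cancel and odd indices double.
  refine HasSum.even_add_odd ?_ ?_
  · convert! hasSum_zero (α := ℂ) (β := ℕ) using 1
    ext k
    rw [← add_div, pow_succ (-z) (2 * k), Even.neg_pow (even_two_mul k)]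
    ring
  · convert! h2 using 1
    ext k
    have hk : ((2 * k + 1 : ℕ) : ℂ) + 1 = ((2 : ℝ) : ℂ) * ((k + 1 : ℝ) : ℂ) := by
      push_cast
      ring
    have h2k : (2 : ℂ) ^ s ≠ 0 := by simp [Complex.cpow_eq_zero_iff]
    rw [hk, Complex.mul_cpow_ofReal_nonneg (by norm_num) (by positivity),
      Complex.cpow_sub _ _ two_ne_zero, Complex.cpow_one,
      Even.neg_pow (show Even (2 * k + 1 + 1) from ⟨k + 1, by ring⟩),
      show 2 * k + 1 + 1 = 2 * (k + 1) by ring, pow_mul]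
    push_cast
    have hk' : ((k : ℂ) + 1) ^ s ≠ 0 := by
      simp [Complex.cpow_eq_zero_iff, Nat.cast_add_one_ne_zero k]
    field_simp
    ring

theorem IsPolylog.add_neg_of_mem {s : ℂ} {L : ℂ → ℂ} (H : IsPolylog s L) {z : ℂ}
    (h1 : z ∈ polylogDomain) (h2 : -z ∈ polylogDomain) :
    L z + L (-z) = 2 ^ (1 - s) * L (z ^ 2) := by
  have hL : DifferentiableOn ℂ L polylogDomain := H.analytic.differentiableOn
  have hopen : IsOpen (polylogDomain ∩ Neg.neg ⁻¹' polylogDomain) :=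
    isOpen_polylogDomain.inter (isOpen_polylogDomain.preimage continuous_neg)
  have hstar : StarConvex ℝ 0 (polylogDomain ∩ Neg.neg ⁻¹' polylogDomain) := by
    refine starConvex_polylogDomain.inter ?_
    rw [starConvex_zero_iff]
    intro w hw u h0 h1
    rw [mem_preimage, ← smul_neg]
    exact (starConvex_zero_iff.1 starConvex_polylogDomain) hw h0 h1
  have h0 : (0 : ℂ) ∈ polylogDomain := mem_polylogDomain_of_norm_lt_one (by simp)
  have h0' : (0 : ℂ) ∈ polylogDomain ∩ Neg.neg ⁻¹' polylogDomain := ⟨h0, by simpa using h0⟩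
  have hf : DifferentiableOn ℂ (fun z => L z + L (-z))
      (polylogDomain ∩ Neg.neg ⁻¹' polylogDomain) :=
    (hL.mono inter_subset_left).add (hL.comp (by fun_prop) fun w hw => hw.2)
  have hg : DifferentiableOn ℂ (fun z => 2 ^ (1 - s) * L (z ^ 2))
      (polylogDomain ∩ Neg.neg ⁻¹' polylogDomain) :=
    (hL.comp (by fun_prop) fun w hw => sq_mem_polylogDomain hw.1 hw.2).const_mul _
  refine (hf.analyticOnNhd hopen).eqOn_of_preconnected_of_eventuallyEq (hg.analyticOnNhd hopen)
    (hstar.isPathConnected h0').isConnected.isPreconnected h0' ?_ ⟨h1, h2⟩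
  filter_upwards [Metric.ball_mem_nhds (0 : ℂ) one_pos] with w hw
  exact H.add_neg_of_norm_lt_one (by simpa using hw)

/-- Near x > 1 squaring preserves the lower half plane, so both cut values are limits from the same
side, while -x is an interior point. -/
theorem IsPolylog.add_neg_of_one_lt {s : ℂ} {L : ℂ → ℂ} (H : IsPolylog s L) {x : ℝ}
    (hx : 1 < x) : L x + L (-x) = 2 ^ (1 - s) * L ((x : ℂ) ^ 2) := by
  have hL : DifferentiableOn ℂ L polylogDomain := H.analytic.differentiableOn
  have hneg : -(x : ℂ) ∈ polylogDomain := fun h => by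
    have := h.2
    simp at this
    linarith
  have h1 : Tendsto (fun z => L (-z)) (𝓝[{z : ℂ | z.im < 0}] (x : ℂ)) (𝓝 (L (-x))) := by
    have hc : ContinuousAt L (-x) :=
      (hL.differentiableAt (isOpen_polylogDomain.mem_nhds hneg)).continuousAt
    exact (hc.tendsto.comp (continuous_neg.tendsto (x : ℂ))).mono_left nhdsWithin_le_nhds
  have hsq : Tendsto (fun z : ℂ => z ^ 2) (𝓝[{z : ℂ | z.im < 0}] (x : ℂ))
      (𝓝[{z : ℂ | z.im < 0}] ((x ^ 2 : ℝ) : ℂ)) := by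
    refine tendsto_nhdsWithin_iff.2 ⟨?_, ?_⟩
    · exact ((continuous_pow 2).tendsto' (x : ℂ) _ (by simp)).mono_left nhdsWithin_le_nhds
    · have hre : ∀ᶠ z : ℂ in 𝓝[{z : ℂ | z.im < 0}] (x : ℂ), 0 < z.re :=
        nhdsWithin_le_nhds ((isOpen_lt continuous_const Complex.continuous_re).mem_nhds
          (show 0 < (x : ℂ).re by simpa using one_pos.trans hx))
      filter_upwards [self_mem_nhdsWithin, hre] with z hz hz'
      have hz0 : z.im < 0 := hz
      have h3 : (z ^ 2).im = 2 * (z.re * z.im) := by rw [sq, Complex.mul_im]; ring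
      simp only [h3]
      nlinarith
  have h2 := ((H.boundary (x ^ 2) (by nlinarith)).comp hsq).const_mul ((2 : ℂ) ^ (1 - s))
  have := neBot_nhdsWithin_im_neg x
  rw [Complex.ofReal_pow] at h2
  refine tendsto_nhds_unique (((H.boundary x hx).add h1).congr' ?_) h2
  filter_upwards [self_mem_nhdsWithin] with z hz
  have hz0 : z.im < 0 := hz
  exact H.add_neg_of_mem (mem_polylogDomain_of_im_ne_zero hz0.ne)
    (mem_polylogDomain_of_im_ne_zero (by simpa using hz0.ne))

theorem exists_ofReal_of_notMem_polylogDomain {z : ℂ} (hz : z ∉ polylogDomain) (hz1 : z ≠ 1) :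
    ∃ x : ℝ, 1 < x ∧ z = x := by
  simp only [polylogDomain, mem_ofPred_eq, not_not] at hz
  have h : z = (z.re : ℂ) := Complex.ext rfl (by simpa using hz.1)
  exact ⟨z.re, lt_of_le_of_ne hz.2 fun h1 => hz1 (by rw [h, ← h1]; simp), h⟩

/-- The duplication formula for the polylogarithm. -/
theorem IsPolylog.add_neg {s : ℂ} {L : ℂ → ℂ} (H : IsPolylog s L) {z : ℂ} (hz : z ^ 2 ≠ 1) :
    L z + L (-z) = 2 ^ (1 - s) * L (z ^ 2) := by
  by_cases h1 : z ∈ polylogDomain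
  · by_cases h2 : -z ∈ polylogDomain
    · exact H.add_neg_of_mem h1 h2
    · obtain ⟨x, hx, hzx⟩ := exists_ofReal_of_notMem_polylogDomain h2
        fun h => hz (by rw [← neg_sq, h, one_pow])
      have := H.add_neg_of_one_lt hx
      rwa [← hzx, neg_neg, neg_sq, add_comm] at this
  · obtain ⟨x, hx, rfl⟩ := exists_ofReal_of_notMem_polylogDomain h1
      fun h => hz (by rw [h, one_pow])
    exact H.add_neg_of_one_lt hx

/-! ### Telescoping and the limit -/

theorem exp_neg_ne_one_of_not_isPeriodPoint {p : ℂ} (hp : ¬ IsPeriodPoint p) :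
    Complex.exp (-p) ≠ 1 := by
  intro h
  obtain ⟨n, hn⟩ := Complex.exp_eq_one_iff.1 h
  refine hp ⟨-n, ?_⟩
  push_cast
  linear_combination -hn

theorem not_isPeriodPoint_div_two {p : ℂ} (hp : ¬ IsPeriodPoint p) : ¬ IsPeriodPoint (p / 2) := by
  rintro ⟨n, hn⟩
  refine hp ⟨2 * n, ?_⟩
  push_cast
  linear_combination 2 * hn

theorem not_isPeriodPoint_div_two_pow {p : ℂ} (hp : ¬ IsPeriodPoint p) (N : ℕ) :
    ¬ IsPeriodPoint (p / 2 ^ N) := by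
  induction N with
  | zero => simpa using hp
  | succ N ih =>
    rw [pow_succ, ← div_div]
    exact not_isPeriodPoint_div_two ih

theorem ne_zero_of_not_isPeriodPoint {p : ℂ} (hp : ¬ IsPeriodPoint p) : p ≠ 0 :=
  fun h => hp ⟨0, by simp [h]⟩

theorem two_cpow_dyadic (s : ℝ) (k : ℕ) :
    (2 : ℂ) ^ (-((k : ℂ) + 1) * (1 - (s : ℂ))) = ((2 : ℂ) ^ ((s : ℂ) - 1)) ^ (k + 1) := by
  rw [← Complex.cpow_nat_mul]
  congr 1
  push_cast
  ring

theorem norm_two_cpow_lt_one {s : ℝ} (hs : s < 1) : ‖(2 : ℂ) ^ ((s : ℂ) - 1)‖ < 1 := by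
  have h : ((2 : ℂ) ^ ((s : ℂ) - 1)) = (((2 : ℝ) ^ (s - 1) : ℝ) : ℂ) := by
    rw [Complex.ofReal_cpow (by norm_num)]
    push_cast
    rfl
  rw [h, Complex.norm_real, Real.norm_of_nonneg (by positivity)]
  exact Real.rpow_lt_one_of_one_lt_of_neg one_lt_two (by linarith)

theorem tendsto_div_two_pow (p : ℂ) : Tendsto (fun N : ℕ => p / 2 ^ N) atTop (𝓝 0) := by
  have := (tendsto_pow_atTop_nhds_zero_of_norm_lt_one
    (show ‖(2 : ℂ)⁻¹‖ < 1 by rw [norm_inv, Complex.norm_ofNat]; norm_num)).const_mul p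
  simpa [div_eq_mul_inv] using this

/-- The polylogarithm factors converge to Li_s(-1), a point of analyticity, so the terms are
dominated by a geometric series of ratio 2^(s-1) < 1. -/
theorem summable_dyadicTerm {s : ℝ} (hs : s < 1) (p : ℂ) : Summable (dyadicTerm s p) := by
  have hP := isPolylog_polylog hs
  have hneg : (-1 : ℂ) ∈ polylogDomain := fun h => by
    have := h.2
    norm_num at this
  have hlim : Tendsto (fun k : ℕ => polylog s (-Complex.exp (-(p / 2 ^ (k + 1))))) atTop
      (𝓝 (polylog s (-1))) := by
    refine (hP.analytic _ hneg).continuousAt.tendsto.comp ?_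
    have h1 := (tendsto_div_two_pow p).comp (tendsto_add_atTop_nat 1)
    have hc : Continuous fun q : ℂ => -Complex.exp (-q) := by fun_prop
    exact (hc.tendsto' 0 (-1) (by simp)).comp h1
  have hgeo : Summable fun k : ℕ => ‖(2 : ℂ) ^ ((s : ℂ) - 1)‖ ^ (k + 1) :=
    (summable_nat_add_iff 1).2
      (summable_geometric_of_lt_one (norm_nonneg _) (norm_two_cpow_lt_one hs))
  refine summable_of_isBigO_nat hgeo ?_
  have h1 : (fun k : ℕ => ((2 : ℂ) ^ ((s : ℂ) - 1)) ^ (k + 1)) =O[atTop]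
      fun k : ℕ => ‖(2 : ℂ) ^ ((s : ℂ) - 1)‖ ^ (k + 1) :=
    Asymptotics.isBigO_of_le _ fun k => by simp
  have h2 := h1.mul (hlim.isBigO_one ℝ)
  simp only [mul_one, ← two_cpow_dyadic] at h2
  exact h2

theorem polylog_sub_sum_dyadicTerm {s : ℝ} (hs : s < 1) {p : ℂ} (hp : ¬ IsPeriodPoint p) (N : ℕ) :
    polylog s (Complex.exp (-p)) - ∑ k ∈ Finset.range N, dyadicTerm s p k =
      ((2 : ℂ) ^ ((s : ℂ) - 1)) ^ N * polylog s (Complex.exp (-(p / 2 ^ N))) := by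
  induction N with
  | zero => simp
  | succ N ih =>
    have hsq : Complex.exp (-(p / 2 ^ (N + 1))) ^ 2 = Complex.exp (-(p / 2 ^ N)) := by
      rw [← Complex.exp_nat_mul]
      congr 1
      push_cast
      field_simp
      ring
    have hdup := (isPolylog_polylog hs).add_neg (z := Complex.exp (-(p / 2 ^ (N + 1)))) (by
      rw [hsq]
      exact exp_neg_ne_one_of_not_isPeriodPoint (not_isPeriodPoint_div_two_pow hp N))
    rw [hsq] at hdup
    have hc : (2 : ℂ) ^ ((s : ℂ) - 1) * (2 : ℂ) ^ (1 - (s : ℂ)) = 1 := by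
      rw [← Complex.cpow_add _ _ two_ne_zero]
      simp
    rw [Finset.sum_range_succ, ← sub_sub, ih, dyadicTerm, two_cpow_dyadic, pow_succ]
    linear_combination ((2 : ℂ) ^ ((s : ℂ) - 1)) ^ N * (-polylog s (Complex.exp (-(p / 2 ^ N))) * hc
      - (2 : ℂ) ^ ((s : ℂ) - 1) * hdup)

/-- Scaling by a positive real leaves the argument unchanged, so no branch correction appears. -/
theorem two_cpow_mul_div_two_cpow (s : ℂ) {p : ℂ} (hp : p ≠ 0) :
    (2 : ℂ) ^ s * (p / 2) ^ s = p ^ s := by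
  have hp2 : p / 2 ≠ 0 := div_ne_zero hp two_ne_zero
  have hlog := Complex.log_ofReal_mul two_pos hp2
  rw [Complex.ofReal_log zero_le_two, Complex.ofReal_ofNat, mul_div_cancel₀ p two_ne_zero] at hlog
  rw [Complex.cpow_def_of_ne_zero two_ne_zero, Complex.cpow_def_of_ne_zero hp2,
    Complex.cpow_def_of_ne_zero hp, hlog, ← Complex.exp_add, add_mul]

theorem two_cpow_pow_mul_div_two_pow_cpow (s : ℂ) {p : ℂ} (hp : p ≠ 0) (N : ℕ) :
    ((2 : ℂ) ^ s) ^ N * (p / 2 ^ N) ^ s = p ^ s := by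
  induction N with
  | zero => simp
  | succ N ih =>
    rw [pow_succ, pow_succ, ← div_div, mul_assoc,
      two_cpow_mul_div_two_cpow s (div_ne_zero hp (pow_ne_zero N two_ne_zero)), ih]

theorem dyadicBracket_eq {s : ℝ} (hs : s < 1) {p : ℂ} (hp : ¬ IsPeriodPoint p) :
    dyadicBracket s p = Real.Gamma (1 - s) * p ^ ((s : ℂ) - 1) := by
  obtain ⟨h, hh, hexp⟩ := exists_polylog_exp_neg_eq hs
  have hdiv := tendsto_div_two_pow p
  have h1 : Tendsto (fun N => polylog s (Complex.exp (-p)) -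
      ∑ k ∈ Finset.range N, dyadicTerm s p k) atTop (𝓝 (dyadicBracket s p)) :=
    (summable_dyadicTerm hs p).hasSum.tendsto_sum_nat.const_sub _
  have h2 : Tendsto (fun N : ℕ => Real.Gamma (1 - s) * p ^ ((s : ℂ) - 1) +
      ((2 : ℂ) ^ ((s : ℂ) - 1)) ^ N * h (p / 2 ^ N)) atTop
      (𝓝 (Real.Gamma (1 - s) * p ^ ((s : ℂ) - 1) + 0 * h 0)) :=
    ((tendsto_pow_atTop_nhds_zero_of_norm_lt_one (norm_two_cpow_lt_one hs)).mul
      (hh.tendsto.comp hdiv)).const_add _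
  rw [zero_mul, add_zero] at h2
  refine tendsto_nhds_unique h1 (h2.congr' ?_)
  -- For large N the point p/2^N has entered the strip where the expansion is valid.
  filter_upwards [hdiv (isOpen_strip.mem_nhds (by simp [Real.pi_pos]))] with N hN
  rw [polylog_sub_sum_dyadicTerm hs hp, hexp _
    (ne_zero_of_not_isPeriodPoint (not_isPeriodPoint_div_two_pow hp N)) hN,
    ← two_cpow_pow_mul_div_two_pow_cpow _ (ne_zero_of_not_isPeriodPoint hp) N]
  ring

/-! ### The coefficient Γ(s) sin(πs) -/

theorem tendsto_gamma_mul_sin {s : ℝ} (hs : s < 1) :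
    Tendsto (fun t : ℝ => Real.Gamma t * Real.sin (Real.pi * t)) (𝓝[≠] s)
      (𝓝 (Real.pi / Real.Gamma (1 - s))) := by
  have hG : Real.Gamma (1 - s) ≠ 0 := (Real.Gamma_pos_of_pos (by linarith)).ne'
  have hc : ContinuousAt (fun t : ℝ => Real.pi / Real.Gamma (1 - t)) s := by
    refine continuousAt_const.div ?_ hG
    have h1 : ContinuousAt Real.Gamma (1 - s) :=
      (Real.differentiableAt_Gamma fun m => by
        have : (0 : ℝ) ≤ m := m.cast_nonneg
        linarith).continuousAt
    exact ContinuousAt.comp' (f := fun t : ℝ => 1 - t) h1 (by fun_prop)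
  refine (hc.tendsto.mono_left nhdsWithin_le_nhds).congr' ?_
  -- Dividing by the sine needs its zeros isolated: it is analytic and equals 1 at t = 1/2.
  have hsin : ∀ᶠ t in 𝓝[≠] s, Real.sin (Real.pi * t) ≠ 0 := by
    have han : AnalyticOnNhd ℝ (fun t : ℝ => Real.sin (Real.pi * t)) univ :=
      fun t _ => by fun_prop
    rcases (han s (mem_univ _)).eventually_eq_zero_or_eventually_ne_zero with h | h
    · have h2 := han.eqOn_zero_of_preconnected_of_eventuallyEq_zero isPreconnected_univ
        (mem_univ s) h (mem_univ (1 / 2 : ℝ))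
      simp only [mul_one_div, Real.sin_pi_div_two] at h2
      exact absurd h2 one_ne_zero
    · exact h
  filter_upwards [hsin, nhdsWithin_le_nhds (gt_mem_nhds hs)] with t ht ht1
  have h1 := Real.Gamma_mul_Gamma_one_sub t
  have h2 : Real.Gamma (1 - t) ≠ 0 := (Real.Gamma_pos_of_pos (by linarith)).ne'
  rw [div_eq_iff h2]
  rw [eq_div_iff ht] at h1
  linear_combination -h1

theorem gammaSin_eq {s : ℝ} (hs : s < 1) : gammaSin s = Real.pi / Real.Gamma (1 - s) :=
  (tendsto_gamma_mul_sin hs).limUnder_eq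

theorem gammaSin_eq_of_ne {s : ℝ} (hs : s < 1) (h : ∀ n : ℕ, s ≠ -(n : ℝ)) :
    gammaSin s = Real.Gamma s * Real.sin (Real.pi * s) := by
  have hc : ContinuousAt (fun t : ℝ => Real.Gamma t * Real.sin (Real.pi * t)) s :=
    (Real.differentiableAt_Gamma h).continuousAt.mul (by fun_prop)
  rw [gammaSin_eq hs]
  exact tendsto_nhds_unique (tendsto_gamma_mul_sin hs)
    (hc.tendsto.mono_left nhdsWithin_le_nhds)

theorem pi_mul_cpow_eq {s : ℝ} (hs : s < 1) {p : ℂ} (hp : ¬ IsPeriodPoint p) :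
    (Real.pi : ℂ) * p ^ ((s : ℂ) - 1) = (gammaSin s : ℂ) * dyadicBracket s p := by
  have hG : (Real.Gamma (1 - s) : ℂ) ≠ 0 :=
    Complex.ofReal_ne_zero.2 (Real.Gamma_pos_of_pos (by linarith)).ne'
  rw [dyadicBracket_eq hs hp, gammaSin_eq hs]
  push_cast
  field_simp

/-! ### Removable singularities -/

theorem eventually_not_isPeriodPoint {p : ℂ} (hp : IsPeriodPoint p) :
    ∀ᶠ q in 𝓝[≠] p, ¬ IsPeriodPoint q := by
  obtain ⟨n, rfl⟩ := hp
  filter_upwards [self_mem_nhdsWithin,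
    nhdsWithin_le_nhds (Metric.ball_mem_nhds _ (show (0 : ℝ) < 2 * Real.pi by positivity))]
    with q hq hq'
  rintro ⟨m, rfl⟩
  have hmn : m - n ≠ 0 := fun h => hq (by rw [sub_eq_zero.1 h]; rfl)
  have h1 : (1 : ℝ) ≤ |((m - n : ℤ) : ℝ)| := by exact_mod_cast Int.one_le_abs hmn
  rw [mem_ball_iff_norm, ← mul_sub, ← Int.cast_sub, norm_mul, norm_mul, Complex.norm_I,
    Complex.norm_intCast] at hq'
  have h2 : ‖(2 * Real.pi : ℂ)‖ = 2 * Real.pi := by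
    simp [abs_of_pos Real.pi_pos]
  rw [h2] at hq'
  nlinarith [Real.pi_pos]

/-- A nonzero period point is off the real axis, so p^(s-1) is continuous there, and nearby points
are not period points. -/
theorem tendsto_dyadicBracket_of_isPeriodPoint {s : ℝ} (hs : s < 1) {p : ℂ} (hp0 : p ≠ 0)
    (hp : IsPeriodPoint p) :
    Tendsto (fun q : ℂ => (gammaSin s : ℂ) * dyadicBracket s q) (𝓝[≠] p)
      (𝓝 ((Real.pi : ℂ) * p ^ ((s : ℂ) - 1))) := by
  have hslit : p ∈ Complex.slitPlane := by
    refine Complex.mem_slitPlane_iff.2 (Or.inr fun him => hp0 ?_)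
    obtain ⟨n, rfl⟩ := hp
    refine Complex.ext (by simp) him
  have hc : ContinuousAt (fun q : ℂ => (Real.pi : ℂ) * q ^ ((s : ℂ) - 1)) p :=
    ((differentiableAt_id.cpow_const hslit).const_mul _).continuousAt
  refine (hc.tendsto.mono_left nhdsWithin_le_nhds).congr' ?_
  filter_upwards [eventually_not_isPeriodPoint hp] with q hq using pi_mul_cpow_eq hs hq

/-! ### The dyadic identity at s = 0 -/

theorem polylog_zero_eq {z : ℂ} (hz : z ≠ 1) : polylog 0 z = z / (1 - z) := by
  have hP : IsPolylog 0 (polylog 0) := by simpa using isPolylog_polylog (zero_lt_one' ℝ)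
  have hsum := hasPolylogExpansion_zero.hasSum
  rw [Complex.ofReal_zero] at hsum
  have heq := hP.eqOn_polylogDomain hsum hasPolylogExpansion_zero.differentiableOn
  by_cases hmem : z ∈ polylogDomain
  · exact heq hmem
  · obtain ⟨x, hx, rfl⟩ := exists_ofReal_of_notMem_polylogDomain hmem hz
    have := neBot_nhdsWithin_im_neg x
    have hc : ContinuousAt (fun z : ℂ => z / (1 - z)) x :=
      continuousAt_id.div (by fun_prop) (sub_ne_zero.2 hz.symm)
    refine tendsto_nhds_unique ((hP.boundary x hx).congr' ?_)
      (hc.tendsto.mono_left nhdsWithin_le_nhds)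
    filter_upwards [self_mem_nhdsWithin] with w hw
    exact heq (mem_polylogDomain_of_im_ne_zero (ne_of_lt hw))

theorem one_add_exp_neg_ne_zero {p : ℂ} (hp : ¬ IsPeriodPoint p) (k : ℕ) :
    1 + Complex.exp (-(p / 2 ^ (k + 1))) ≠ 0 := by
  intro h
  apply exp_neg_ne_one_of_not_isPeriodPoint (not_isPeriodPoint_div_two_pow hp k)
  have hsq : Complex.exp (-(p / 2 ^ (k + 1))) ^ 2 = Complex.exp (-(p / 2 ^ k)) := by
    rw [← Complex.exp_nat_mul]
    congr 1
    push_cast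
    field_simp
    ring
  rw [← hsq, ← neg_sq, show -Complex.exp (-(p / 2 ^ (k + 1))) = 1 by linear_combination -h,
    one_pow]

/-- This is -x/(1 + x) = 1/(1 + x) - 1; the subtracted powers of 1/2 sum to 1, matching the 1 in
z/(1 - z) = 1/(1 - z) - 1. -/
theorem dyadicTerm_zero_eq {p : ℂ} (hp : ¬ IsPeriodPoint p) (k : ℕ) :
    dyadicTerm 0 p k =
      1 / 2 ^ (k + 1) / (1 + Complex.exp (-(p / 2 ^ (k + 1)))) - (1 / 2) ^ (k + 1) := by
  have hne := one_add_exp_neg_ne_zero hp k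
  have h1 : -Complex.exp (-(p / 2 ^ (k + 1))) ≠ 1 := fun h => hne (by linear_combination -h)
  rw [dyadicTerm, two_cpow_dyadic, Complex.ofReal_zero, polylog_zero_eq h1, sub_neg_eq_add,
    zero_sub, Complex.cpow_neg_one, one_div_pow, inv_pow]
  field_simp
  ring

theorem hasSum_half_pow_succ : HasSum (fun k : ℕ => (1 / 2 : ℂ) ^ (k + 1)) 1 := by
  have h := (hasSum_geometric_of_norm_lt_one (ξ := (1 / 2 : ℂ))
    (by rw [norm_div, norm_one, Complex.norm_ofNat]; norm_num)).mul_left (1 / 2 : ℂ)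
  simp_rw [pow_succ']
  convert! h using 1
  norm_num

theorem hasSum_dyadic_fermi {p : ℂ} (hp : ¬ IsPeriodPoint p) :
    HasSum (fun k : ℕ => 1 / 2 ^ (k + 1) / (1 + Complex.exp (-(p / 2 ^ (k + 1)))))
      (∑' k : ℕ, dyadicTerm 0 p k + 1) := by
  have h := (summable_dyadicTerm zero_lt_one p).hasSum.add hasSum_half_pow_succ
  simpa only [dyadicTerm_zero_eq hp, sub_add_cancel] using h

theorem dyadicBracket_zero_eq {p : ℂ} (hp : ¬ IsPeriodPoint p) :
    dyadicBracket 0 p = 1 / (1 - Complex.exp (-p)) -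
      ∑' k : ℕ, 1 / 2 ^ (k + 1) / (1 + Complex.exp (-(p / 2 ^ (k + 1)))) := by
  have hne := exp_neg_ne_one_of_not_isPeriodPoint hp
  have hne' : 1 - Complex.exp (-p) ≠ 0 := sub_ne_zero.2 hne.symm
  rw [(hasSum_dyadic_fermi hp).tsum_eq, dyadicBracket, Complex.ofReal_zero, polylog_zero_eq hne]
  field_simp
  ring

end

theorem lemma18 (s : ℝ) (hs : s < 1) :
    -- the polylogarithm and the coefficient are well defined
    IsPolylog s (polylog s) ∧
    Tendsto (fun t : ℝ => Real.Gamma t * Real.sin (Real.pi * t)) (𝓝[≠] s) (𝓝 (gammaSin s)) ∧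
    ((∀ n : ℕ, s ≠ -(n : ℝ)) → gammaSin s = Real.Gamma s * Real.sin (Real.pi * s)) ∧
    -- the identity away from the points `2 π i n`
    (∀ p : ℂ, ¬ IsPeriodPoint p →
      Summable (dyadicTerm s p) ∧
      (Real.pi : ℂ) * p ^ ((s : ℂ) - 1) = (gammaSin s : ℂ) * dyadicBracket s p) ∧
    -- the points `2 π i n`, `n ≠ 0`, are removable singularities and the identity persists there
    (∀ p : ℂ, p ≠ 0 → IsPeriodPoint p →
      Tendsto (fun q : ℂ => (gammaSin s : ℂ) * dyadicBracket s q) (𝓝[≠] p)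
        (𝓝 ((Real.pi : ℂ) * p ^ ((s : ℂ) - 1)))) ∧
    -- for `s = 0` the identity is the dyadic identity for `1 / p`
    (s = 0 → gammaSin s = Real.pi ∧
      ∀ p : ℂ, ¬ IsPeriodPoint p →
        p ^ ((s : ℂ) - 1) = 1 / p ∧
        Summable (fun k : ℕ => 1 / 2 ^ (k + 1) / (1 + Complex.exp (-(p / 2 ^ (k + 1))))) ∧
        dyadicBracket s p = 1 / (1 - Complex.exp (-p)) -
          ∑' k : ℕ, 1 / 2 ^ (k + 1) / (1 + Complex.exp (-(p / 2 ^ (k + 1)))) ∧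
        1 / p = 1 / (1 - Complex.exp (-p)) -
          ∑' k : ℕ, 1 / 2 ^ (k + 1) / (1 + Complex.exp (-(p / 2 ^ (k + 1))))) := by
  refine ⟨isPolylog_polylog hs, ?_, gammaSin_eq_of_ne hs,
    fun p hp => ⟨summable_dyadicTerm hs p, pi_mul_cpow_eq hs hp⟩,
    fun p hp0 hp => tendsto_dyadicBracket_of_isPeriodPoint hs hp0 hp, ?_⟩
  · rw [gammaSin_eq hs]
    exact tendsto_gamma_mul_sin hs
  · rintro rfl
    refine ⟨by simp [gammaSin_eq hs], fun p hp => ?_⟩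
    have hpow : p ^ (((0 : ℝ) : ℂ) - 1) = 1 / p := by
      simp [Complex.cpow_neg_one]
    have hbr := dyadicBracket_zero_eq hp
    refine ⟨hpow, (hasSum_dyadic_fermi hp).summable, hbr, ?_⟩
    rw [← hbr, dyadicBracket_eq hs hp, hpow]
    simp
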